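/- Let $G=C_n$ be a finite cyclic group of order $n\ge 1$. For $k\mid n$ let $C_k\le G$ be the unique subgroup of order $k$. For a subgroup $H\le G$ let $A(H)$ be the Burnside ring of $H$ (the ring of formal differences of isomorphism classes of finite $H$-sets, with disjoint union as sum and Cartesian product as multiplication); it is the value at $G/H$ of the Burnside Tambara functor $\underline{A}_G$. For $I\le H$ and $p$ prime or $0$ let $\varphi_{H,p}^I\colon A(H)\to\mathbb{Z}/p\mathbb{Z}$ be the ring homomorphism that sends a finite $H$-set $X$ to $|X^I| \bmod p$ (with $\mathbb{Z}/0\mathbb{Z}=\mathbb{Z}$). For $C\le G$ let $\mathfrak{p}_{C,p}$ be the family of ideals $$\mathfrak{p}_{C,p}(G/H)=\bigcap_{\substack{I\le H\\ g^{-1}Ig\le C\text{ for some }g\in G}}\ker\varphi_{H,p}^I\subseteq A(H)\qquad(H\le G),$$ and write $\mathfrak{p}_{C,p}\subseteq\mathfrak{p}_{D,q}$ if $\mathfrak{p}_{C,p}(G/H)\subseteq\mathfrak{p}_{D,q}(G/H)$ for all $H\le G$. Let $\nu_p(k)$ be the exponent of $p$ in $k$. Then for all $i,j\mid n$ and all primes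 $p,q$: 1. $\mathfrak{p}_{C_i,0}\subseteq\mathfrak{p}_{C_j,0}$ if and only if $j\mid i$; 2. $\mathfrak{p}_{C_i,0}\subsetneq\mathfrak{p}_{C_i,p}$, and $\mathfrak{p}_{C_i,p}\not\subseteq\mathfrak{p}_{C_j,0}$; 3. $\mathfrak{p}_{C_i,p}\subseteq\mathfrak{p}_{C_j,q}$ if and only if $p=q$ and $C_{j/p^{\nu_p(j)}}\le C_{i/p^{\nu_p(i)}}$; and $\mathfrak{p}_{C_i,p}=\mathfrak{p}_{C_j,q}$ if and only if $p=q$ and $C_{i/p^{\nu_p(i)}}=C_{j/p^{\nu_p(j)}}$. -/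

import Mathlib

universe u v

/-! ### The Grothendieck ring of a commutative semiring -/

/-- The Grothendieck ring of formal differences of elements of a commutative semiring `S`. Its
additive group is Mathlib's Grothendieck group of the additive monoid of `S`. -/
def GrothendieckRing (S : Type u) [CommSemiring S] : Type u := Algebra.GrothendieckAddGroup S

namespace GrothendieckRing

open Algebra

variable {S : Type u} [CommSemiring S]

noncomputable instance : AddCommGroup (GrothendieckRing S) :=
  inferInstanceAs (AddCommGroup (GrothendieckAddGroup S))

/-- The canonical additive map from a semiring to its Grothendieck ring. -/
noncomputable def of : S →+ GrothendieckRing S := (GrothendieckAddGroup.of : S →+ _)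

/-- Extension of an additive map from the semiring to its Grothendieck ring. -/
noncomputable def liftAdd {B : Type v} [AddCommGroup B] (f : S →+ B) : GrothendieckRing S →+ B :=
  GrothendieckAddGroup.lift f

@[simp]
theorem liftAdd_of {B : Type v} [AddCommGroup B] (f : S →+ B) (a : S) :
    liftAdd f (of a) = f a :=
  DFunLike.congr_fun (GrothendieckAddGroup.lift.symm_apply_apply f) a

/-- Every element is a formal difference. -/
theorem exists_sub (x : GrothendieckRing S) : ∃ a b : S, x = of a - of b := by
  induction x using AddLocalization.ind with
  | H y =>
    refine ⟨y.1, y.2, ?_⟩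
    have h := (AddLocalization.addMonoidOf (⊤ : AddSubmonoid S)).mk'_spec y.1 y.2
    rw [← AddLocalization.mk_eq_addMonoidOf_mk'] at h
    exact eq_sub_of_add_eq (G := GrothendieckAddGroup S) h

/-- The multiplication, as the biadditive extension of the multiplication of `S`. -/
noncomputable def mulHom : GrothendieckRing S →+ GrothendieckRing S →+ GrothendieckRing S :=
  liftAdd
    { toFun := fun a => liftAdd (of.comp (AddMonoidHom.mulLeft a))
      map_zero' := by
        ext x
        obtain ⟨b, c, rfl⟩ := exists_sub x
        simp
      map_add' := fun a a' => by
        ext x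
        obtain ⟨b, c, rfl⟩ := exists_sub x
        simp [add_mul]
        abel }

noncomputable instance : Mul (GrothendieckRing S) := ⟨fun x y => mulHom x y⟩

noncomputable instance : One (GrothendieckRing S) := ⟨of 1⟩

theorem mul_def (x y : GrothendieckRing S) : x * y = mulHom x y := rfl

theorem one_def : (1 : GrothendieckRing S) = of 1 := rfl

theorem of_mul_of (a b : S) : (of a * of b : GrothendieckRing S) = of (a * b) := by
  simp [mul_def, mulHom]

theorem add_mul' (x y z : GrothendieckRing S) : (x + y) * z = x * z + y * z := by
  simp [mul_def]

theorem mul_add' (x y z : GrothendieckRing S) : x * (y + z) = x * y + x * z := by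
  simp [mul_def]

theorem sub_mul' (x y z : GrothendieckRing S) : (x - y) * z = x * z - y * z := by
  simp [mul_def]

theorem mul_sub' (x y z : GrothendieckRing S) : x * (y - z) = x * y - x * z := by
  simp [mul_def]

noncomputable instance : CommRing (GrothendieckRing S) :=
  { (inferInstance : AddCommGroup (GrothendieckRing S)) with
    mul := (· * ·)
    one := 1
    left_distrib := mul_add'
    right_distrib := add_mul'
    zero_mul := fun x => by simp [mul_def]
    mul_zero := fun x => by simp [mul_def]
    mul_assoc := fun x y z => by
      obtain ⟨a, b, rfl⟩ := exists_sub x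
      obtain ⟨c, d, rfl⟩ := exists_sub y
      obtain ⟨e, f, rfl⟩ := exists_sub z
      simp only [sub_mul', mul_sub', of_mul_of, mul_assoc]
    one_mul := fun x => by
      obtain ⟨a, b, rfl⟩ := exists_sub x
      simp only [one_def, mul_sub', of_mul_of, one_mul]
    mul_one := fun x => by
      obtain ⟨a, b, rfl⟩ := exists_sub x
      simp only [one_def, sub_mul', of_mul_of, mul_one]
    mul_comm := fun x y => by
      obtain ⟨a, b, rfl⟩ := exists_sub x
      obtain ⟨c, d, rfl⟩ := exists_sub y
      simp only [sub_mul', mul_sub', of_mul_of, mul_comm c, mul_comm d]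
      abel }

/-- The extension of a semiring homomorphism into a commutative ring to the Grothendieck ring. -/
noncomputable def lift {R : Type v} [CommRing R] (f : S →+* R) : GrothendieckRing S →+* R :=
  { liftAdd (f : S →+ R) with
    map_one' := by
      change liftAdd (f : S →+ R) (of 1) = 1
      simp
    map_mul' := fun x y => by
      change liftAdd (f : S →+ R) (x * y) = liftAdd (f : S →+ R) x * liftAdd (f : S →+ R) y
      obtain ⟨a, b, rfl⟩ := exists_sub x
      obtain ⟨c, d, rfl⟩ := exists_sub y
      simp only [sub_mul', mul_sub', of_mul_of, map_sub, liftAdd_of]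
      simp
      ring }

@[simp]
theorem lift_of {R : Type v} [CommRing R] (f : S →+* R) (a : S) : lift f (of a) = f a :=
  liftAdd_of (f : S →+ R) a

end GrothendieckRing

/-! ### Finite `G`-sets, the Burnside ring and marks -/

/-- A finite `G`-set. -/
structure FinGSet (G : Type u) [Group G] : Type (u + 1) where
  carrier : Type u
  [action : MulAction G carrier]
  [finite : Finite carrier]

attribute [instance] FinGSet.action FinGSet.finite

namespace FinGSet

variable (G : Type u) [Group G]

/-- Two finite `G`-sets are isomorphic if there is a `G`-equivariant bijection between them. -/
def isoSetoid : Setoid (FinGSet G) where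
  r X Y := ∃ e : X.carrier ≃ Y.carrier, ∀ (g : G) (x : X.carrier), e (g • x) = g • e x
  iseqv :=
    { refl := fun X => ⟨Equiv.refl _, fun _ _ => rfl⟩
      symm := by
        rintro X Y ⟨e, he⟩
        refine ⟨e.symm, fun g y => ?_⟩
        rw [Equiv.symm_apply_eq, he, Equiv.apply_symm_apply]
      trans := by
        rintro X Y Z ⟨e, he⟩ ⟨f, hf⟩
        exact ⟨e.trans f, fun g x => by simp [he, hf]⟩ }

variable {G}

/-- The empty `G`-set. -/
def empty : FinGSet G :=
  letI : MulAction G PEmpty.{u + 1} :=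
    { smul := fun _ x => x
      one_smul := fun _ => rfl
      mul_smul := fun _ _ _ => rfl }
  ⟨PEmpty.{u + 1}⟩

/-- The one-point `G`-set. -/
def point : FinGSet G := ⟨PUnit.{u + 1}⟩

/-- Disjoint union, with the action on each of the two summands. -/
def sum (X Y : FinGSet G) : FinGSet G := ⟨X.carrier ⊕ Y.carrier⟩

/-- Cartesian product, with the diagonal action. -/
def prod (X Y : FinGSet G) : FinGSet G := ⟨X.carrier × Y.carrier⟩

/-- The set of points of `X` that are fixed by all elements of `I`. -/
def fixed (I : Subgroup G) (X : FinGSet G) : Set X.carrier := {x | ∀ g ∈ I, g • x = x}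

end FinGSet

/-- The isomorphism classes of finite `G`-sets. -/
def FinGSetClass (G : Type u) [Group G] : Type (u + 1) := Quotient (FinGSet.isoSetoid G)

namespace FinGSetClass

variable {G : Type u} [Group G]

/-- The isomorphism class of a finite `G`-set. -/
def mk (X : FinGSet G) : FinGSetClass G := Quotient.mk (FinGSet.isoSetoid G) X

theorem mk_eq {X Y : FinGSet G} (e : X.carrier ≃ Y.carrier)
    (he : ∀ (g : G) (x : X.carrier), e (g • x) = g • e x) : mk X = mk Y :=
  Quotient.sound ⟨e, he⟩

instance : Zero (FinGSetClass G) := ⟨mk FinGSet.empty⟩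

instance : One (FinGSetClass G) := ⟨mk FinGSet.point⟩

instance : Add (FinGSetClass G) :=
  ⟨Quotient.map₂ FinGSet.sum (by
    rintro X X' ⟨e, he⟩ Y Y' ⟨f, hf⟩
    refine ⟨Equiv.sumCongr e f, ?_⟩
    rintro g (x | y)
    · exact congrArg Sum.inl (he g x)
    · exact congrArg Sum.inr (hf g y))⟩

instance : Mul (FinGSetClass G) :=
  ⟨Quotient.map₂ FinGSet.prod (by
    rintro X X' ⟨e, he⟩ Y Y' ⟨f, hf⟩
    exact ⟨Equiv.prodCongr e f, fun g x => Prod.ext (he g x.1) (hf g x.2)⟩)⟩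

theorem mk_add (X Y : FinGSet G) : mk X + mk Y = mk (X.sum Y) := rfl

theorem mk_mul (X Y : FinGSet G) : mk X * mk Y = mk (X.prod Y) := rfl

protected theorem add_comm' (a b : FinGSetClass G) : a + b = b + a := by
  induction a, b using Quotient.inductionOn₂ with | _ X Y
  refine mk_eq (X := X.sum Y) (Y := Y.sum X) (Equiv.sumComm _ _) ?_
  rintro g (x | y) <;> rfl

protected theorem zero_add' (a : FinGSetClass G) : 0 + a = a := by
  induction a using Quotient.inductionOn with | _ X
  refine mk_eq (X := FinGSet.empty.sum X) (Y := X) (Equiv.emptySum PEmpty X.carrier) ?_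
  rintro g (x | x)
  · exact x.elim
  · rfl

protected theorem mul_comm' (a b : FinGSetClass G) : a * b = b * a := by
  induction a, b using Quotient.inductionOn₂ with | _ X Y
  exact mk_eq (X := X.prod Y) (Y := Y.prod X) (Equiv.prodComm _ _) fun _ _ => rfl

protected theorem one_mul' (a : FinGSetClass G) : 1 * a = a := by
  induction a using Quotient.inductionOn with | _ X
  exact mk_eq (X := FinGSet.point.prod X) (Y := X) (Equiv.punitProd _) fun _ _ => rfl

protected theorem zero_mul' (a : FinGSetClass G) : 0 * a = 0 := by
  induction a using Quotient.inductionOn with | _ X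
  exact mk_eq (X := FinGSet.empty.prod X) (Y := FinGSet.empty)
    (Equiv.pemptyProd X.carrier) fun _ x => x.1.elim

protected theorem add_mul' (a b c : FinGSetClass G) : (a + b) * c = a * c + b * c := by
  induction a, b, c using Quotient.inductionOn₃ with | _ X Y Z
  refine mk_eq (X := (X.sum Y).prod Z) (Y := (X.prod Z).sum (Y.prod Z))
    (Equiv.sumProdDistrib _ _ _) ?_
  rintro g ⟨x | x, z⟩ <;> rfl

/-- Isomorphism classes of finite `G`-sets form a commutative semiring under disjoint union and
Cartesian product. -/
instance : CommSemiring (FinGSetClass G) where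
  add_assoc a b c := by
    induction a, b, c using Quotient.inductionOn₃ with | _ X Y Z
    refine mk_eq (X := (X.sum Y).sum Z) (Y := X.sum (Y.sum Z)) (Equiv.sumAssoc _ _ _) ?_
    rintro g ((x | y) | z) <;> rfl
  zero_add := FinGSetClass.zero_add'
  add_zero a := by rw [FinGSetClass.add_comm', FinGSetClass.zero_add']
  add_comm := FinGSetClass.add_comm'
  mul_assoc a b c := by
    induction a, b, c using Quotient.inductionOn₃ with | _ X Y Z
    exact mk_eq (X := (X.prod Y).prod Z) (Y := X.prod (Y.prod Z)) (Equiv.prodAssoc _ _ _)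
      fun _ _ => rfl
  one_mul := FinGSetClass.one_mul'
  mul_one a := by rw [FinGSetClass.mul_comm', FinGSetClass.one_mul']
  mul_comm := FinGSetClass.mul_comm'
  zero_mul := FinGSetClass.zero_mul'
  mul_zero a := by rw [FinGSetClass.mul_comm', FinGSetClass.zero_mul']
  right_distrib := FinGSetClass.add_mul'
  left_distrib a b c := by
    rw [FinGSetClass.mul_comm', FinGSetClass.add_mul', FinGSetClass.mul_comm' b,
      FinGSetClass.mul_comm' c]
  nsmul := nsmulRec
  npow := npowRec

/-- The number `|X^I|` of `I`-fixed points, on isomorphism classes of finite `G`-sets. -/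
noncomputable def card (I : Subgroup G) : FinGSetClass G → ℕ :=
  Quotient.lift (fun X => Nat.card (X.fixed I)) (by
    rintro X Y ⟨e, he⟩
    refine Nat.card_congr (e.subtypeEquiv fun x => ?_)
    simp only [FinGSet.fixed, Set.mem_ofPred_eq, ← he, e.apply_eq_iff_eq])

theorem card_mk (I : Subgroup G) (X : FinGSet G) : card I (mk X) = Nat.card (X.fixed I) := rfl

/-- The number of `I`-fixed points, as a homomorphism of semirings. -/
noncomputable def cardHom (I : Subgroup G) : FinGSetClass G →+* ℤ where
  toFun a := (card I a : ℤ)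
  map_zero' := by
    have : IsEmpty ((FinGSet.empty : FinGSet G).fixed I) := ⟨fun x => x.1.elim⟩
    change ((Nat.card ((FinGSet.empty : FinGSet G).fixed I) : ℕ) : ℤ) = 0
    simp
  map_one' := by
    have h : (FinGSet.point : FinGSet G).fixed I = Set.univ :=
      Set.eq_univ_of_forall fun _ _ _ => rfl
    change ((Nat.card ((FinGSet.point : FinGSet G).fixed I) : ℕ) : ℤ) = 1
    rw [h, Nat.card_congr (Equiv.Set.univ _)]
    exact congrArg Nat.cast (Nat.card_unique (α := PUnit))
  map_add' a b := by
    induction a, b using Quotient.inductionOn₂ with | _ X Y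
    change ((Nat.card ((X.sum Y).fixed I) : ℕ) : ℤ)
      = (Nat.card (X.fixed I) : ℤ) + (Nat.card (Y.fixed I) : ℤ)
    rw [← Nat.cast_add, ← Nat.card_sum]
    refine congrArg Nat.cast (Nat.card_congr ?_)
    exact
      { toFun := fun x => match x with
          | ⟨Sum.inl x, h⟩ => Sum.inl ⟨x, fun g hg => Sum.inl_injective (h g hg)⟩
          | ⟨Sum.inr y, h⟩ => Sum.inr ⟨y, fun g hg => Sum.inr_injective (h g hg)⟩
        invFun := fun x => match x with
          | Sum.inl x => ⟨Sum.inl x.1, fun g hg => congrArg Sum.inl (x.2 g hg)⟩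
          | Sum.inr y => ⟨Sum.inr y.1, fun g hg => congrArg Sum.inr (y.2 g hg)⟩
        left_inv := by rintro ⟨x | x, h⟩ <;> rfl
        right_inv := by rintro (x | x) <;> rfl }
  map_mul' a b := by
    induction a, b using Quotient.inductionOn₂ with | _ X Y
    change ((Nat.card ((X.prod Y).fixed I) : ℕ) : ℤ)
      = (Nat.card (X.fixed I) : ℤ) * (Nat.card (Y.fixed I) : ℤ)
    rw [← Nat.cast_mul, ← Nat.card_prod]
    refine congrArg Nat.cast (Nat.card_congr ?_)
    exact
      { toFun := fun x => ⟨⟨x.1.1, fun g hg => congrArg Prod.fst (x.2 g hg)⟩,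
          ⟨x.1.2, fun g hg => congrArg Prod.snd (x.2 g hg)⟩⟩
        invFun := fun x => ⟨(x.1.1, x.2.1), fun g hg => Prod.ext (x.1.2 g hg) (x.2.2 g hg)⟩
        left_inv := fun _ => rfl
        right_inv := fun _ => rfl }

end FinGSetClass

/-- The Burnside ring `A(G)`: formal differences of isomorphism classes of finite `G`-sets. -/
abbrev BurnsideRing (G : Type u) [Group G] : Type (u + 1) := GrothendieckRing (FinGSetClass G)

namespace BurnsideRing

variable {G : Type u} [Group G]

/-- The class of a finite `G`-set in the Burnside ring. -/
noncomputable def cls (X : FinGSet G) : BurnsideRing G := GrothendieckRing.of (FinGSetClass.mk X)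

/-- The mark homomorphism `φ_G^I : A(G) → ℤ`, determined by `X ↦ |X^I|` on finite `G`-sets. -/
noncomputable def mark (I : Subgroup G) : BurnsideRing G →+* ℤ :=
  GrothendieckRing.lift (FinGSetClass.cardHom I)

theorem mark_cls (I : Subgroup G) (X : FinGSet G) :
    mark I (cls X) = (Nat.card (X.fixed I) : ℤ) :=
  GrothendieckRing.lift_of _ _

/-- The mark homomorphism modulo `p`, written `φ_{G,p}^I : A(G) → ℤ/pℤ`; for `p = 0` the target
`ZMod 0` is `ℤ` and this is the mark itself. -/
noncomputable def markMod (p : ℕ) (I : Subgroup G) : BurnsideRing G →+* ZMod p :=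
  (Int.castRingHom (ZMod p)).comp (mark I)

end BurnsideRing

/-! ### The ideals `𝔭_{C,p}` -/

/-- `I` is subconjugate to `C` in `G`: there is `g ∈ G` with `I^g = g⁻¹ I g ≤ C`. -/
def Subconj {G : Type u} [Group G] (I C : Subgroup G) : Prop :=
  ∃ g : G, ∀ x ∈ I, g⁻¹ * x * g ∈ C

/-- A family of ideals `𝓘(G/H)` of the rings `A_G(G/H) = A(H)`, one for each subgroup `H` of `G`.
Such families are ordered by levelwise inclusion, which is the order of a product. -/
abbrev BurnsideIdealFamily (G : Type u) [Group G] : Type (u + 1) :=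
  (H : Subgroup G) → Ideal (BurnsideRing H)

/-- The family `𝔭_{C,p}`, whose value at `G/H` is the intersection of the kernels of the marks
`φ_{H,p}^I` on `A(H)`, over all subgroups `I` of `H` that are subconjugate to `C` in `G`. -/
noncomputable def burnsidePrime {G : Type u} [Group G] (C : Subgroup G) (p : ℕ) :
    BurnsideIdealFamily G :=
  fun H => ⨅ (I : Subgroup H) (_ : Subconj (I.map H.subtype) C),
    RingHom.ker (BurnsideRing.markMod p I)

/-! ### The subgroups of a cyclic group -/

/-- The subgroup of `G` generated by the solutions of `x ^ k = 1`. In a finite cyclic group `G`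
whose order is divisible by `k` this is `C_k`, the only subgroup of order `k`. -/
def cyclicSubgroup (G : Type u) [Group G] (k : ℕ) : Subgroup G :=
  Subgroup.closure {x | x ^ k = 1}

theorem card_cyclicSubgroup {G : Type u} [Group G] [Finite G] [IsCyclic G] {k : ℕ}
    (hk : k ∣ Nat.card G) : Nat.card (cyclicSubgroup G k) = k := by
  let _ : CommGroup G := IsCyclic.commGroup
  have h : cyclicSubgroup G k = (powMonoidHom k : G →* G).ker := by
    rw [← Subgroup.closure_eq (powMonoidHom k : G →* G).ker]
    rfl
  rw [h, IsCyclic.card_powMonoidHom_ker, Nat.gcd_eq_right hk]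

theorem eq_cyclicSubgroup {G : Type u} [Group G] [Finite G] [IsCyclic G] {k : ℕ}
    (K : Subgroup G) (hK : Nat.card K = k) : K = cyclicSubgroup G k := by
  have hk : k ∣ Nat.card G := hK ▸ K.card_subgroup_dvd_card
  refine Subgroup.eq_of_le_of_card_ge (fun x hx => Subgroup.subset_closure ?_) ?_
  · have : (⟨x, hx⟩ : K) ^ Nat.card K = 1 := pow_card_eq_one'
    rw [hK] at this
    exact congrArg Subtype.val this
  · rw [card_cyclicSubgroup hk, hK]

/-! All subgroups of a cyclic group are normal, so subconjugacy is containment, and `burnsidePrime C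
p H` consists of the elements whose marks mod `p` vanish at every subgroup of `H ∩ C`. Enlarging `C`
therefore shrinks the ideals. Inclusions mod `p` come from a congruence
(`BurnsideRing.markMod_sup`): joining a `p`-group to a normal subgroup does not change marks mod
`p`, so only the prime-to-`p` part of `C` matters. Non-inclusions come from two test elements. The
constant `p` at the trivial subgroup compares residue characteristics
(`natCast_eq_zero_of_burnsidePrime_le`). The element `[H/(H ∩ C)] - |H : H ∩ C|` has zero mark at
each `I ≤ H ∩ C`, but mark `-|H : H ∩ C|` at `H` when `H` is not inside `C`
(`natCast_relIndex_eq_zero_of_burnsidePrime_le`). -/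

/-! ### Subgroups of cyclic groups and membership in the ideals -/

theorem mem_cyclicSubgroup {G : Type u} [Group G] [IsCyclic G] {k : ℕ} {x : G} :
    x ∈ cyclicSubgroup G k ↔ x ^ k = 1 := by
  let _ : CommGroup G := IsCyclic.commGroup
  have h : cyclicSubgroup G k = (powMonoidHom k : G →* G).ker := by
    rw [← Subgroup.closure_eq (powMonoidHom k : G →* G).ker]
    rfl
  rw [h]
  rfl

theorem Subgroup.normal_of_isCyclic {G : Type u} [Group G] [IsCyclic G] (K : Subgroup G) :
    K.Normal := by
  let _ : CommGroup G := IsCyclic.commGroup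
  exact ⟨fun a ha g => by rwa [mul_comm g a, mul_inv_cancel_right]⟩

theorem cyclicSubgroup_le_iff {G : Type u} [Group G] [Finite G] [IsCyclic G] {a b : ℕ}
    (ha : a ∣ Nat.card G) (hb : b ∣ Nat.card G) :
    cyclicSubgroup G a ≤ cyclicSubgroup G b ↔ a ∣ b := by
  constructor
  · intro h
    simpa only [card_cyclicSubgroup ha, card_cyclicSubgroup hb] using Subgroup.card_dvd_of_le h
  · rintro ⟨c, rfl⟩ x hx
    rw [mem_cyclicSubgroup] at hx ⊢
    rw [pow_mul, hx, one_pow]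

theorem subconj_iff_le {G : Type u} [Group G] {I C : Subgroup G} [hC : C.Normal] :
    Subconj I C ↔ I ≤ C := by
  constructor
  · rintro ⟨g, hg⟩ x hx
    simpa [mul_assoc] using hC.conj_mem _ (hg x hx) g
  · intro h
    exact ⟨1, fun x hx => by simpa using h hx⟩

theorem mem_burnsidePrime {G : Type u} [Group G] {C : Subgroup G} [C.Normal] {p : ℕ}
    {H : Subgroup G} {x : BurnsideRing H} :
    x ∈ burnsidePrime C p H ↔
      ∀ I : Subgroup H, I.map H.subtype ≤ C → BurnsideRing.markMod p I x = 0 := by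
  simp only [burnsidePrime, subconj_iff_le, Submodule.mem_iInf, RingHom.mem_ker]

theorem BurnsideRing.markMod_apply {G : Type u} [Group G] (p : ℕ) (I : Subgroup G)
    (x : BurnsideRing G) : BurnsideRing.markMod p I x = ((BurnsideRing.mark I x : ℤ) : ZMod p) :=
  rfl

/-! ### Congruences between marks -/

/-- The action of a group on the points fixed by a normal subgroup. -/
@[reducible]
def FinGSet.fixedMulAction {G : Type u} [Group G] (K : Subgroup G) [hK : K.Normal]
    (X : FinGSet G) : MulAction G (X.fixed K) where
  smul g x := ⟨g • x.1, fun k hk => by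
    -- By normality `g⁻¹ * k * g` lies in `K` and so fixes `x`; hence `k` fixes `g • x`.
    have h := x.2 (g⁻¹ * k * g) (by simpa using hK.conj_mem k hk g⁻¹)
    rw [mul_smul, mul_smul, inv_smul_eq_iff] at h
    exact h⟩
  one_smul x := Subtype.ext (one_smul G x.1)
  mul_smul g h x := Subtype.ext (mul_smul g h x.1)

/-- Adjoining a `p`-group to a normal subgroup does not change the number of fixed points
modulo `p`. -/
theorem FinGSet.card_fixed_sup_modEq {G : Type u} [Group G] {p : ℕ} [Fact p.Prime]
    (K P : Subgroup G) [K.Normal] (hP : IsPGroup p P) (X : FinGSet G) :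
    Nat.card (X.fixed (K ⊔ P)) ≡ Nat.card (X.fixed K) [MOD p] := by
  let _ : MulAction G (X.fixed K) := X.fixedMulAction K
  -- Orbits of a `p`-group have `p`-power length, so `X^K` and its `P`-fixed points, which form
  -- `X^(K ⊔ P)`, have congruent sizes.
  have h := hP.card_modEq_card_fixedPoints (X.fixed K)
  refine Nat.ModEq.trans (congrArg (· % p) (Nat.card_congr ?_)) h.symm
  exact
    { toFun := fun x => ⟨⟨x.1, fun k hk => x.2 k (le_sup_left (a := K) hk)⟩,
        fun g => Subtype.ext (x.2 g (le_sup_right (a := K) g.2))⟩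
      invFun := fun x => ⟨x.1.1, by
        have hle : K ⊔ P ≤ MulAction.stabilizer G x.1.1 :=
          sup_le (fun k hk => x.1.2 k hk)
            (fun g hg => congrArg Subtype.val (x.2 ⟨g, hg⟩))
        exact fun g hg => hle hg⟩
      left_inv := fun _ => rfl
      right_inv := fun _ => rfl }

theorem BurnsideRing.markMod_sup {G : Type u} [Group G] {p : ℕ} [Fact p.Prime]
    (K P : Subgroup G) [K.Normal] (hP : IsPGroup p P) :
    BurnsideRing.markMod p (K ⊔ P) = BurnsideRing.markMod p K := by
  have key : ∀ a : FinGSetClass G, BurnsideRing.markMod p (K ⊔ P) (GrothendieckRing.of a) =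
      BurnsideRing.markMod p K (GrothendieckRing.of a) := by
    intro a
    induction a using Quotient.inductionOn with | _ X
    change BurnsideRing.markMod p (K ⊔ P) (BurnsideRing.cls X) =
      BurnsideRing.markMod p K (BurnsideRing.cls X)
    simp only [BurnsideRing.markMod_apply, BurnsideRing.mark_cls, Int.cast_natCast]
    exact (ZMod.natCast_eq_natCast_iff _ _ _).2 (X.card_fixed_sup_modEq K P hP)
  ext x
  obtain ⟨a, b, rfl⟩ := GrothendieckRing.exists_sub x
  rw [map_sub, map_sub, key, key]

/-! ### Test elements and necessary conditions for inclusion -/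

/-- The `G`-set of cosets of a subgroup. -/
def FinGSet.coset {G : Type u} [Group G] [Finite G] (D : Subgroup G) : FinGSet G := ⟨G ⧸ D⟩

/-- All points of `G ⧸ D` have stabilizer `D` when `D` is normal, so `I` fixes either every coset or
none. -/
theorem FinGSet.mem_fixed_coset {G : Type u} [Group G] [Finite G] {D I : Subgroup G}
    [hD : D.Normal] {x : G ⧸ D} : x ∈ (FinGSet.coset D).fixed I ↔ I ≤ D := by
  induction x using QuotientGroup.induction_on with | _ a
  refine forall₂_congr fun g _ => ?_
  change ((g * a : G) : G ⧸ D) = (a : G ⧸ D) ↔ g ∈ D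
  rw [QuotientGroup.mk_mul, mul_eq_right, QuotientGroup.eq_one_iff]

theorem BurnsideRing.mark_coset_of_le {G : Type u} [Group G] [Finite G] {D I : Subgroup G}
    [D.Normal] (h : I ≤ D) : BurnsideRing.mark I (cls (FinGSet.coset D)) = D.index := by
  have huniv : (FinGSet.coset D).fixed I = Set.univ :=
    Set.eq_univ_of_forall fun _ => FinGSet.mem_fixed_coset.2 h
  rw [mark_cls, huniv, Nat.card_congr (Equiv.Set.univ _)]
  rfl

theorem BurnsideRing.mark_coset_of_not_le {G : Type u} [Group G] [Finite G] {D I : Subgroup G}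
    [D.Normal] (h : ¬ I ≤ D) : BurnsideRing.mark I (cls (FinGSet.coset D)) = 0 := by
  have : IsEmpty ((FinGSet.coset D).fixed I) :=
    ⟨fun x => h (FinGSet.mem_fixed_coset.1 x.2)⟩
  rw [mark_cls, Nat.card_of_isEmpty, Nat.cast_zero]

/-- The mark at `H` itself must kill the test element on the larger side, because `H ≤ E`. There the
coset part contributes nothing, and only the index survives. -/
theorem natCast_relIndex_eq_zero_of_burnsidePrime_le {G : Type u} [Group G] [Finite G]
    {C E H : Subgroup G} [C.Normal] [E.Normal] {p q : ℕ}
    (h : burnsidePrime C p ≤ burnsidePrime E q) (hHE : H ≤ E) (hHC : ¬ H ≤ C) :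
    (C.relIndex H : ZMod q) = 0 := by
  have hx : BurnsideRing.cls (FinGSet.coset (C.subgroupOf H)) -
      ((C.subgroupOf H).index : BurnsideRing H) ∈ burnsidePrime C p H := by
    rw [mem_burnsidePrime]
    intro I hI
    replace hI : I ≤ C.subgroupOf H := Subgroup.map_le_iff_le_comap.1 hI
    rw [BurnsideRing.markMod_apply, map_sub, BurnsideRing.mark_coset_of_le hI, map_natCast,
      sub_self, Int.cast_zero]
  have htop := mem_burnsidePrime.1 (h H hx) ⊤
    (by rwa [← MonoidHom.range_eq_map, Subgroup.range_subtype])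
  have hnot : ¬ (⊤ : Subgroup H) ≤ C.subgroupOf H := by
    rwa [top_le_iff, Subgroup.subgroupOf_eq_top]
  rw [BurnsideRing.markMod_apply, map_sub, BurnsideRing.mark_coset_of_not_le hnot,
    map_natCast, zero_sub, Int.cast_neg, neg_eq_zero, Int.cast_natCast] at htop
  exact htop

theorem natCast_eq_zero_of_burnsidePrime_le {G : Type u} [Group G] {C E : Subgroup G}
    [C.Normal] [E.Normal] {p q : ℕ} (h : burnsidePrime C p ≤ burnsidePrime E q) :
    (p : ZMod q) = 0 := by
  have hx : (p : BurnsideRing (⊥ : Subgroup G)) ∈ burnsidePrime C p ⊥ := by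
    rw [mem_burnsidePrime]
    intro I _
    rw [map_natCast, ZMod.natCast_self]
  have hbot := mem_burnsidePrime.1 (h ⊥ hx) ⊥ (by simp)
  rwa [map_natCast] at hbot

theorem burnsidePrime_anti {G : Type u} [Group G] {C E : Subgroup G} [C.Normal] [E.Normal]
    (p : ℕ) (h : C ≤ E) : burnsidePrime E p ≤ burnsidePrime C p := by
  intro H x hx
  rw [mem_burnsidePrime] at hx ⊢
  exact fun I hI => hx I (hI.trans h)

theorem burnsidePrime_zero_le {G : Type u} [Group G] (C : Subgroup G) [C.Normal] (p : ℕ) :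
    burnsidePrime C 0 ≤ burnsidePrime C p := by
  intro H x hx
  rw [mem_burnsidePrime] at hx ⊢
  intro I hI
  have h : BurnsideRing.mark I x = 0 := hx I hI
  rw [BurnsideRing.markMod_apply, h, Int.cast_zero]

/-! ### Prime-to-`p` parts and the inclusion criteria -/

theorem cyclicSubgroup_sup_of_coprime {G : Type u} [Group G] [Finite G] [IsCyclic G] {a b : ℕ}
    (hab : a.Coprime b) (h : a * b ∣ Nat.card G) :
    cyclicSubgroup G a ⊔ cyclicSubgroup G b = cyclicSubgroup G (a * b) := by
  have ha : a ∣ Nat.card G := (Dvd.intro _ rfl).trans h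
  have hb : b ∣ Nat.card G := (Dvd.intro_left _ rfl).trans h
  refine Subgroup.eq_of_le_of_card_ge (sup_le ((cyclicSubgroup_le_iff ha h).2 (Dvd.intro _ rfl))
    ((cyclicSubgroup_le_iff hb h).2 (Dvd.intro_left _ rfl))) ?_
  rw [card_cyclicSubgroup h]
  refine Nat.le_of_dvd Nat.card_pos (hab.mul_dvd_of_dvd_of_dvd ?_ ?_)
  · simpa only [card_cyclicSubgroup ha] using Subgroup.card_dvd_of_le
      (le_sup_left : cyclicSubgroup G a ≤ cyclicSubgroup G a ⊔ cyclicSubgroup G b)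
  · simpa only [card_cyclicSubgroup hb] using Subgroup.card_dvd_of_le
      (le_sup_right : cyclicSubgroup G b ≤ cyclicSubgroup G a ⊔ cyclicSubgroup G b)

/-- Modulo `p`, the marks at the subgroups of `C_j` are determined by those at the subgroups of
its prime-to-`p` part. -/
theorem burnsidePrime_le_of_primeToPart_le {G : Type u} [Group G] [Finite G] [IsCyclic G]
    {p j : ℕ} [Fact p.Prime] {C : Subgroup G} (hj : j ∣ Nat.card G)
    (h : cyclicSubgroup G (j / p ^ j.factorization p) ≤ C) :
    burnsidePrime C p ≤ burnsidePrime (cyclicSubgroup G j) p := by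
  have := C.normal_of_isCyclic
  have := (cyclicSubgroup G j).normal_of_isCyclic
  intro H x hx
  rw [mem_burnsidePrime] at hx ⊢
  intro I hI
  set m := Nat.card I with hm
  have hm0 : m ≠ 0 := Nat.card_pos.ne'
  have hmH : m ∣ Nat.card H := I.card_subgroup_dvd_card
  have hmj : m ∣ j := by
    have h1 := Subgroup.card_dvd_of_le hI
    rwa [card_cyclicSubgroup hj, Subgroup.card_map_of_injective H.subtype_injective] at h1
  have hmul : m / p ^ m.factorization p * p ^ m.factorization p = m :=
    Nat.div_mul_cancel (Nat.ordProj_dvd m p)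
  have hcop : (m / p ^ m.factorization p).Coprime (p ^ m.factorization p) :=
    ((Nat.coprime_ordCompl Fact.out hm0).pow_left _).symm
  -- Being the only subgroup of `H` of order `m`, `I` is the join of its prime-to-`p` part and its
  -- `p`-part; the latter can be dropped mod `p`.
  have hsup := cyclicSubgroup_sup_of_coprime hcop (hmul.symm ▸ hmH)
  rw [hmul, ← eq_cyclicSubgroup I hm.symm] at hsup
  have hP : IsPGroup p (cyclicSubgroup H (p ^ m.factorization p)) :=
    IsPGroup.of_card (card_cyclicSubgroup ((Nat.ordProj_dvd m p).trans hmH))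
  have := (cyclicSubgroup H (m / p ^ m.factorization p)).normal_of_isCyclic
  rw [← hsup, BurnsideRing.markMod_sup _ _ hP]
  refine hx _ (le_trans ?_ h)
  rintro _ ⟨y, hy, rfl⟩
  -- Since `m ∣ j`, the prime-to-`p` part of `m` divides that of `j`, which places the prime-to-`p`
  -- part of `I` inside `C`.
  obtain ⟨c, hc⟩ := Nat.ordCompl_dvd_ordCompl_of_dvd hmj p
  rw [SetLike.mem_coe, mem_cyclicSubgroup] at hy
  rw [mem_cyclicSubgroup, hc, pow_mul, ← map_pow, hy, map_one, one_pow]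

theorem burnsidePrime_zero_le_iff {G : Type u} [Group G] [Finite G] [IsCyclic G] {i j : ℕ}
    (hi : i ∣ Nat.card G) (hj : j ∣ Nat.card G) :
    burnsidePrime (cyclicSubgroup G i) 0 ≤ burnsidePrime (cyclicSubgroup G j) 0 ↔ j ∣ i := by
  have := (cyclicSubgroup G i).normal_of_isCyclic
  have := (cyclicSubgroup G j).normal_of_isCyclic
  rw [← cyclicSubgroup_le_iff hj hi]
  refine ⟨fun h => ?_, burnsidePrime_anti 0⟩
  by_contra hle
  -- The test is made at `H = C_j`; in `ZMod 0 = ℤ` a positive index cannot vanish.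
  have h0 := natCast_relIndex_eq_zero_of_burnsidePrime_le h le_rfl hle
  have h1 := Subgroup.relIndex_dvd_card (cyclicSubgroup G i) (cyclicSubgroup G j)
  exact ne_zero_of_dvd_ne_zero Nat.card_pos.ne' h1 (Nat.cast_injective (R := ℤ) h0)

theorem burnsidePrime_le_iff {G : Type u} [Group G] [Finite G] [IsCyclic G] {i j p q : ℕ}
    (hi : i ∣ Nat.card G) (hj : j ∣ Nat.card G) (hp : p.Prime) (hq : q.Prime) :
    burnsidePrime (cyclicSubgroup G i) p ≤ burnsidePrime (cyclicSubgroup G j) q ↔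
      p = q ∧ cyclicSubgroup G (j / p ^ j.factorization p) ≤
        cyclicSubgroup G (i / p ^ i.factorization p) := by
  have := (cyclicSubgroup G i).normal_of_isCyclic
  have := (cyclicSubgroup G j).normal_of_isCyclic
  have hj0 : j ≠ 0 := ne_zero_of_dvd_ne_zero Nat.card_pos.ne' hj
  have hi' : i / p ^ i.factorization p ∣ Nat.card G := (Nat.ordCompl_dvd i p).trans hi
  have hj' : j / p ^ j.factorization p ∣ Nat.card G := (Nat.ordCompl_dvd j p).trans hj
  have hcop : Nat.Coprime p (j / p ^ j.factorization p) := Nat.coprime_ordCompl hp hj0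
  constructor
  · intro h
    obtain rfl : p = q := by
      have h0 := natCast_eq_zero_of_burnsidePrime_le h
      rw [ZMod.natCast_eq_zero_iff] at h0
      exact ((Nat.prime_dvd_prime_iff_eq hq hp).1 h0).symm
    refine ⟨rfl, ?_⟩
    rw [cyclicSubgroup_le_iff hj' hi']
    -- A divisor of `i` that is prime to `p` already divides the prime-to-`p` part of `i`.
    suffices hdvd : j / p ^ j.factorization p ∣ i by
      refine (hcop.symm.pow_right (i.factorization p)).dvd_of_dvd_mul_left ?_
      rwa [Nat.ordProj_mul_ordCompl_eq_self]
    rw [← cyclicSubgroup_le_iff hj' hi]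
    by_contra hle
    -- The test is made at `H`, the prime-to-`p` part of `C_j`: the index divides the order of `H`,
    -- so `p` cannot divide it.
    have h0 := natCast_relIndex_eq_zero_of_burnsidePrime_le h
      ((cyclicSubgroup_le_iff hj' hj).2 (Nat.ordCompl_dvd j p)) hle
    rw [ZMod.natCast_eq_zero_iff] at h0
    have h1 := h0.trans (Subgroup.relIndex_dvd_card _ _)
    rw [card_cyclicSubgroup hj'] at h1
    exact (Nat.Prime.coprime_iff_not_dvd hp).1 hcop h1
  · rintro ⟨rfl, h⟩
    have : Fact p.Prime := ⟨hp⟩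
    exact burnsidePrime_le_of_primeToPart_le hj
      (h.trans ((cyclicSubgroup_le_iff hi' hi).2 (Nat.ordCompl_dvd i p)))

theorem corollary5p5 {G : Type u} [Group G] [Finite G] [IsCyclic G] (n : ℕ) (hn : Nat.card G = n)
    (i j : ℕ) (hi : i ∣ n) (hj : j ∣ n) (p q : ℕ) (hp : p.Prime) (hq : q.Prime) :
    (burnsidePrime (cyclicSubgroup G i) 0 ≤ burnsidePrime (cyclicSubgroup G j) 0 ↔ j ∣ i) ∧
    (burnsidePrime (cyclicSubgroup G i) 0 < burnsidePrime (cyclicSubgroup G i) p ∧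
      ¬ burnsidePrime (cyclicSubgroup G i) p ≤ burnsidePrime (cyclicSubgroup G j) 0) ∧
    (burnsidePrime (cyclicSubgroup G i) p ≤ burnsidePrime (cyclicSubgroup G j) q ↔
      p = q ∧ cyclicSubgroup G (j / p ^ j.factorization p) ≤
        cyclicSubgroup G (i / p ^ i.factorization p)) ∧
    (burnsidePrime (cyclicSubgroup G i) p = burnsidePrime (cyclicSubgroup G j) q ↔
      p = q ∧ cyclicSubgroup G (i / p ^ i.factorization p) =
        cyclicSubgroup G (j / p ^ j.factorization p)) := by
  subst hn
  have hnot : ∀ k : ℕ,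
      ¬ burnsidePrime (cyclicSubgroup G i) p ≤ burnsidePrime (cyclicSubgroup G k) 0 := by
    intro k h
    have := (cyclicSubgroup G i).normal_of_isCyclic
    have := (cyclicSubgroup G k).normal_of_isCyclic
    exact hp.ne_zero (Nat.cast_injective (R := ℤ) (natCast_eq_zero_of_burnsidePrime_le h))
  have := (cyclicSubgroup G i).normal_of_isCyclic
  refine ⟨burnsidePrime_zero_le_iff hi hj, ⟨⟨burnsidePrime_zero_le _ p, hnot i⟩, hnot j⟩,
    burnsidePrime_le_iff hi hj hp hq, ?_⟩
  -- The reverse inclusion is stated with `q`-parts; they become `p`-parts once `p = q` is known.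
  rw [le_antisymm_iff, burnsidePrime_le_iff hi hj hp hq, burnsidePrime_le_iff hj hi hq hp]
  constructor
  · rintro ⟨⟨rfl, h⟩, -, h'⟩
    exact ⟨rfl, le_antisymm h' h⟩
  · rintro ⟨rfl, h⟩
    exact ⟨⟨rfl, h.ge⟩, rfl, h.le⟩
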